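/- Let $(X,d)$ be a metric space with a Borel measure $\mu$ that is doubling with constant $D$, i.e. $\mu(B(x,2r))\le D\,\mu(B(x,r))<\infty$ for all $x\in X$, $r>0$. Let $0<\delta<1$ and let $\mathscr D=\{Q_\alpha^k\}$ be a system of dyadic cubes with parameter $\delta$. That is, for each $k\in\mathbb Z$ a countable maximal $\delta^k$-separated set $\{z_\alpha^k\}_\alpha\subseteq X$ is given, these sets increase with $k$, and the $Q_\alpha^k$ are Borel sets such that: for every $k$ the cubes $Q^k_\alpha$ are pairwise disjoint with union $X$; $P\cap Q\in\{\emptyset,P,Q\}$ for all $P,Q\in\mathscr D$; $B(z_\alpha^k,\tfrac15\delta^k)\subseteq Q_\alpha^k\subseteq B(z_\alpha^k,3\delta^k)$; and $Q_\alpha^k$ is the union of the cubes $Q_\beta^{k+m}\subseteq Q_\alpha^k$, for every integer $m\ge 0$. The children of $Q=Q_\alpha^k$ are the cubes $Q_\beta^{k+1}\subseteq Q$. Cubes are understood together with their level $k$ and index $\alpha$. Let $h_Q^\theta\colon X\to\mathbb R$ ($Q\in\mathscr D$, $1\le\theta\le n(Q)\le\Theta$, where $n(Q)=0$ is allowed)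 be Haar functions: each $h_Q^\theta$ vanishes outside $Q$, is constant on every child of $Q$, and satisfies $\int h_Q^\theta\,d\mu=0$, $\|h_Q^\theta\|_{L^2(\mu)}=1$, and $\int h_Q^\theta h_Q^{\theta'}\,d\mu=0$ for $\theta\ne\theta'$. Let $E$ be a real UMD Banach space: for every $p\in(1,\infty)$ there is a constant $\beta_p$ such that $$\Big\|\sum_{i=1}^N\sigma_i d_i\Big\|_{L^p(S;E)}\le\beta_p\Big\|\sum_{i=1}^N d_i\Big\|_{L^p(S;E)}$$ for all measure spaces $S$, all $E$-valued $L^p$-martingale difference sequences $(d_i)_{i=1}^N$ on $S$ with respect to $\sigma$-finite sub-$\sigma$-algebras $\mathscr F_0\subseteq\dots\subseteq\mathscr F_N$, and all signs $\sigma_i\in\{-1,+1\}$. **Lemma.** Let $p\in(1,\infty)$. There is a constant $C$, depending only on $p$, $D$, $\delta$ and $\beta_p$, such that the following holds. For every finite set $\mathcal Q$ of cubes with $n(Q)\ge1$, every choice of one Haar function $h_Q=h_Q^{\theta(Q)}$ for each $Q\in\mathcal Q$, all $x_Q\in E$, and all random signs $(\varepsilon_Q)_{Q\in\mathcal Q}$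 on a probability space $(\Omega,\mathbb P)$ (independent, with $\mathbb P(\varepsilon_Q=1)=\mathbb P(\varepsilon_Q=-1)=\tfrac12$), $$\frac1C\,\Big\|\sum_{Q\in\mathcal Q}\varepsilon_Q x_Q\frac{1_Q}{\mu(Q)^{1/2}}\Big\|_{\Omega,p}\le\Big\|\sum_{Q\in\mathcal Q}x_Qh_Q\Big\|_{L^p(X;E)}\le C\,\Big\|\sum_{Q\in\mathcal Q}\varepsilon_Q x_Q\frac{1_Q}{\mu(Q)^{1/2}}\Big\|_{\Omega,p},$$ where $\big\|\sum_Q\varepsilon_Q f_Q\big\|_{\Omega,p}=\big(\int_\Omega\|\sum_Q\varepsilon_Q(\eta)f_Q\|_{L^p(X;E)}^p\,d\mathbb P(\eta)\big)^{1/p}$. -/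

import Mathlib

open MeasureTheory ProbabilityTheory
open scoped ENNReal NNReal

universe u v w

noncomputable section

/-- `μ` is doubling with constant `D`: `μ (2B) ≤ D μ (B) < ∞` for every ball `B`. -/
def IsDoublingMeasure {X : Type u} [MetricSpace X] [MeasurableSpace X]
    (μ : Measure X) (D : ℝ≥0) : Prop :=
  ∀ (x : X) (r : ℝ), 0 < r →
    μ (Metric.ball x (2 * r)) ≤ D * μ (Metric.ball x r) ∧ μ (Metric.ball x r) < ∞

/-- A system of dyadic cubes with parameter `δ` in a metric space. The cubes of level `k` are
indexed by the points of a maximal `δ ^ k`-separated set, and these sets are nested. -/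
structure DyadicSystem (X : Type u) [MetricSpace X] [MeasurableSpace X] (δ : ℝ) where
  /-- the centre points of level `k` -/
  centers : ℤ → Set X
  countable_centers : ∀ k, (centers k).Countable
  centers_subset_succ : ∀ k, centers k ⊆ centers (k + 1)
  separated : ∀ k, (centers k).Pairwise fun y z => δ ^ k ≤ dist y z
  maximal : ∀ (k : ℤ) (x : X), ∃ z ∈ centers k, dist x z < δ ^ k
  /-- the cube of level `k` with a given centre -/
  cube : ∀ k : ℤ, centers k → Set X
  measurableSet_cube : ∀ k α, MeasurableSet (cube k α)
  iUnion_cube : ∀ k, ⋃ α, cube k α = Set.univ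
  disjoint_cube : ∀ k α β, α ≠ β → Disjoint (cube k α) (cube k β)
  inter_cube : ∀ k l α β,
    cube k α ∩ cube l β = ∅ ∨ cube k α ∩ cube l β = cube k α ∨ cube k α ∩ cube l β = cube l β
  ball_subset_cube : ∀ k (α : centers k), Metric.ball (α : X) (1 / 5 * δ ^ k) ⊆ cube k α
  cube_subset_ball : ∀ k (α : centers k), cube k α ⊆ Metric.ball (α : X) (3 * δ ^ k)
  cube_eq_iUnion : ∀ k α (m : ℕ),
    cube k α = ⋃ β : {β : centers (k + m) // cube (k + m) β ⊆ cube k α}, cube (k + m) β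

namespace DyadicSystem

variable {X : Type u} [MetricSpace X] [MeasurableSpace X] {δ : ℝ}

/-- A cube of the system, recorded as its level together with its centre point. -/
abbrev Cube (𝒟 : DyadicSystem X δ) : Type u := Σ k : ℤ, 𝒟.centers k

/-- The set of points of a cube. -/
def toSet (𝒟 : DyadicSystem X δ) (Q : 𝒟.Cube) : Set X := 𝒟.cube Q.1 Q.2

/-- `R` is a child cube of `Q`: it has the next level and is contained in `Q`. -/
def IsChild (𝒟 : DyadicSystem X δ) (R Q : 𝒟.Cube) : Prop :=
  R.1 = Q.1 + 1 ∧ 𝒟.toSet R ⊆ 𝒟.toSet Q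

end DyadicSystem

/-- Haar functions `h_Q^θ`, `θ = 1, …, n(Q) ≤ Θ`, attached to the cubes of a dyadic system.
`n Q = 0` is allowed; it is forced when `Q` has only one child.
Density of the linear span in `L²` is not required. -/
structure HaarSystem {X : Type u} [MetricSpace X] [MeasurableSpace X] {δ : ℝ}
    (𝒟 : DyadicSystem X δ) (μ : Measure X) where
  /-- the number of Haar functions of a cube -/
  n : 𝒟.Cube → ℕ
  bounded : ∃ Θ : ℕ, ∀ Q, n Q ≤ Θ
  /-- the Haar functions of a cube -/
  h : ∀ Q : 𝒟.Cube, Fin (n Q) → X → ℝ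
  support_subset : ∀ Q θ, Function.support (h Q θ) ⊆ 𝒟.toSet Q
  const_on_child : ∀ Q θ R, 𝒟.IsChild R Q → ∃ c : ℝ, ∀ y ∈ 𝒟.toSet R, h Q θ y = c
  integral_eq_zero : ∀ Q θ, ∫ y, h Q θ y ∂μ = 0
  integral_mul_eq_zero : ∀ Q θ θ', θ ≠ θ' → ∫ y, h Q θ y * h Q θ' y ∂μ = 0
  norm_eq_one : ∀ Q θ, eLpNorm (h Q θ) 2 μ = 1

/-- `d 0, …, d (N - 1)` is an `L^p` martingale difference sequence for the filtration
`𝓕 0 ≤ … ≤ 𝓕 N` of σ-finite sub-σ-algebras: each `d i` is in `L^p`, is `𝓕 (i + 1)`-measurable,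
and has conditional expectation zero given `𝓕 i`. The last condition is spelled out through
integrals over sets of finite measure, since an `L^p` function on a space of infinite measure
need not be integrable. -/
structure IsLpMartingaleDifference {S : Type u} {mS : MeasurableSpace S} {E : Type v}
    [NormedAddCommGroup E] [NormedSpace ℝ E] (p : ℝ) (μ : Measure S) {N : ℕ}
    (𝓕 : Filtration (Fin (N + 1)) mS) (d : Fin N → S → E) : Prop where
  sigmaFinite : ∀ i, SigmaFinite (μ.trim (𝓕.le i))
  memLp : ∀ i, MemLp (d i) (ENNReal.ofReal p) μ
  stronglyMeasurable : ∀ i, StronglyMeasurable[𝓕 i.succ] (d i)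
  setIntegral_eq_zero : ∀ i (G : Set S), MeasurableSet[𝓕 i.castSucc] G → μ G < ∞ →
    ∫ s in G, d i s ∂μ = 0

/-- `β` is an admissible UMD constant of `E` for the exponent `p`. -/
def HasUMDConstant (E : Type v) [NormedAddCommGroup E] [NormedSpace ℝ E] (p β : ℝ) : Prop :=
  ∀ (S : Type u) (mS : MeasurableSpace S) (μ : Measure S) (N : ℕ)
    (𝓕 : Filtration (Fin (N + 1)) mS) (d : Fin N → S → E),
    IsLpMartingaleDifference p μ 𝓕 d →
    ∀ σ : Fin N → ℝ, (∀ i, σ i = 1 ∨ σ i = -1) →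
      eLpNorm (fun s => ∑ i, σ i • d i s) (ENNReal.ofReal p) μ ≤
        ENNReal.ofReal β * eLpNorm (fun s => ∑ i, d i s) (ENNReal.ofReal p) μ

/-- `E` has unconditional martingale differences. -/
def IsUMD (E : Type v) [NormedAddCommGroup E] [NormedSpace ℝ E] : Prop :=
  ∀ p : ℝ, 1 < p → ∃ β : ℝ, HasUMDConstant.{u, v} E p β

/-- Random signs: independent random variables with values `1` and `-1`, each of
probability `1 / 2`. -/
structure IsRandomSigns {Ω : Type w} [MeasurableSpace Ω] {ι : Type u} (ε : ι → Ω → ℝ)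
    (P : Measure Ω) : Prop where
  measurable : ∀ i, Measurable (ε i)
  indep : iIndepFun ε P
  prob_one : ∀ i, P {η | ε i η = 1} = 1 / 2
  prob_neg_one : ∀ i, P {η | ε i η = -1} = 1 / 2

/-- The randomized norm `‖f‖_{Ω,p} = (∫_Ω ‖f(η)‖_p^p dP(η))^{1/p}`. -/
def randomizedNorm {Ω : Type w} [MeasurableSpace Ω] {X : Type u} [MeasurableSpace X] {E : Type v}
    [NormedAddCommGroup E] (p : ℝ) (P : Measure Ω) (μ : Measure X) (f : Ω → X → E) : ℝ≥0∞ :=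
  (∫⁻ η, eLpNorm (f η) (ENNReal.ofReal p) μ ^ p ∂P) ^ (1 / p)

end

/-!
Order the cubes by level. Since a Haar function has mean zero and is constant on every later cube,
the functions `x_Q h_Q` form a martingale difference sequence, and the UMD property compares
`∑ x_Q h_Q` with `∑ σ_Q x_Q h_Q` for all fixed signs, hence with the randomized sum
`∑ ε_Q x_Q h_Q` (`HaarSystem.eLpNorm_fst_le_and_ge`). It remains to compare `h_Q` with
`1_Q / μ(Q)^{1/2}` under random signs.

* By doubling, a child of `Q` carries a fixed fraction of `μ(Q)`, so `‖h_Q‖_2 = 1` gives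
  `|h_Q| ≤ c 1_Q / μ(Q)^{1/2}` (`HaarSystem.abs_h_le`). The contraction principle
  (`signNorm_le_mul`), applied at each point, yields one direction.
* Conversely, `1 = ∫ h_Q² ≤ ‖h_Q‖_∞ ∫ |h_Q|` shows that the mean `c_Q` of `|h_Q|` over `Q` is at
  least `μ(Q)^{-1/2} / c` (`HaarSystem.inv_sqrt_le_average`). Stein's inequality is needed only for
  these means (`signNorm_indicator_average_le`): on the product of `X` with the space of signs, the
  functions `ε_Q x_Q c_Q 1_Q` and `ε_Q x_Q (|h_Q| - c_Q 1_Q)`, taken alternately, form a martingale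
  difference sequence with sum `∑ ε_Q x_Q |h_Q|`, and the UMD property bounds the sum of the
  former ones. Only the exponent `p` is used.

The filtrations consist of the σ-algebras of sets that do not split any atom of a later step, where
the atoms are the cubes, or the cubes times the sign vectors with a given past
(`HasUMDConstant.eLpNorm_sum_le`). Random signs on an arbitrary probability space are replaced by
the counting measure on all sign vectors (`IsRandomSigns.randomizedNorm_eq`).
-/

/-! ### Sign vectors and the contraction principle -/

/-- The real sign encoded by a Boolean. -/
def boolSign (b : Bool) : ℝ := if b then 1 else -1

theorem boolSign_eq (b : Bool) : boolSign b = 1 ∨ boolSign b = -1 := by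
  cases b <;> simp [boolSign]

theorem boolSign_not (b : Bool) : boolSign (!b) = -boolSign b := by
  cases b <;> simp [boolSign]

theorem boolSign_beq (a b : Bool) : boolSign (a == b) = boolSign a * boolSign b := by
  cases a <;> cases b <;> simp [boolSign]

theorem boolSign_decide {t : ℝ} (ht : t = 1 ∨ t = -1) : boolSign (decide (t = 1)) = t := by
  rcases ht with rfl | rfl <;> norm_num [boolSign]

/-- Multiplication of all sign vectors by a fixed one. -/
def signMulEquiv {ι : Type*} (τ : ι → Bool) : (ι → Bool) ≃ (ι → Bool) where
  toFun ω i := ω i == τ i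
  invFun ω i := ω i == τ i
  left_inv ω := by ext i; cases h : ω i <;> cases h' : τ i <;> simp [h, h']
  right_inv ω := by ext i; cases h : ω i <;> cases h' : τ i <;> simp [h, h']

section Contraction

variable {ι : Type*} [Fintype ι] [DecidableEq ι]
  {E : Type*} [NormedAddCommGroup E] [NormedSpace ℝ E]

theorem convexOn_sum_norm_rpow {p : ℝ} (hp : 1 ≤ p) (x : ι → E) :
    ConvexOn ℝ Set.univ fun t : ι → ℝ =>
      ∑ ω : ι → Bool, ‖∑ i, (boolSign (ω i) * t i) • x i‖ ^ p := by
  suffices h : ∀ ω : ι → Bool, ConvexOn ℝ Set.univ fun t : ι → ℝ =>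
      ‖∑ i, (boolSign (ω i) * t i) • x i‖ ^ p by
    refine ⟨convex_univ, fun s hs t ht a b ha hb hab => ?_⟩
    simp only [Finset.smul_sum, ← Finset.sum_add_distrib]
    exact Finset.sum_le_sum fun ω _ => (h ω).2 hs ht ha hb hab
  intro ω
  let L : (ι → ℝ) →ₗ[ℝ] E := ∑ i, ((boolSign (ω i) • LinearMap.proj i :
    (ι → ℝ) →ₗ[ℝ] ℝ).smulRight (x i))
  have hL : ∀ t : ι → ℝ, ∑ i, (boolSign (ω i) * t i) • x i = L t := by
    intro t; simp [L, LinearMap.sum_apply]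
  simp only [hL]
  have h1 : ConvexOn ℝ Set.univ fun t : ι → ℝ => ‖L t‖ := by
    exact (convexOn_univ_norm (E := E)).comp_linearMap L
  refine ⟨convex_univ, fun s _ t _ a b ha hb hab => ?_⟩
  have h2 := h1.2 (Set.mem_univ s) (Set.mem_univ t) ha hb hab
  calc ‖L (a • s + b • t)‖ ^ p ≤ (a • ‖L s‖ + b • ‖L t‖) ^ p :=
        Real.rpow_le_rpow (norm_nonneg _) h2 (by linarith)
    _ ≤ _ := (convexOn_rpow hp).2 (norm_nonneg _) (norm_nonneg _) ha hb hab

/-- Kahane's contraction principle for sums over all choices of signs. Writing `a = t b` with `t` in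
the cube `[-1, 1] ^ ι`, the left side is convex in `t`, so it is largest at a vertex of the cube,
where it equals the right side by symmetry. -/
theorem sum_norm_rpow_le_of_abs_le {p : ℝ} (hp : 1 ≤ p) (x : ι → E) {a b : ι → ℝ}
    (hab : ∀ i, |a i| ≤ |b i|) :
    ∑ ω : ι → Bool, ‖∑ i, (boolSign (ω i) * a i) • x i‖ ^ p ≤
      ∑ ω : ι → Bool, ‖∑ i, (boolSign (ω i) * b i) • x i‖ ^ p := by
  have key := convexOn_sum_norm_rpow hp (fun i => b i • x i)
  -- where `b i = 0`, also `a i = 0`, so the junk value `t i = 0` is harmless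
  let t : ι → ℝ := fun i => a i / b i
  have ht : t ∈ convexHull ℝ (Set.univ.pi fun _ : ι => ({-1, 1} : Set ℝ)) := by
    rw [convexHull_pi]
    intro i _
    rw [convexHull_pair, segment_eq_Icc (by norm_num)]
    refine abs_le.1 ?_
    simp only [t, abs_div]
    exact div_le_one_of_le₀ (hab i) (abs_nonneg _)
  obtain ⟨s, hs, hts⟩ := (key.subset (Set.subset_univ _)
    (convex_convexHull ℝ _)).exists_ge_of_mem_convexHull (subset_convexHull ℝ _) ht
  have hta : ∀ i, t i * b i = a i := by
    intro i
    by_cases hb : b i = 0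
    · have := hab i
      simp only [hb, abs_zero, abs_nonpos_iff] at this
      simp [hb, this]
    · simp [t, hb]
  have hl : ∀ ω : ι → Bool, ∑ i, (boolSign (ω i) * t i) • b i • x i
      = ∑ i, (boolSign (ω i) * a i) • x i := by
    intro ω
    refine Finset.sum_congr rfl fun i _ => ?_
    rw [smul_smul, mul_assoc, hta]
  simp only [hl] at hts
  refine hts.trans (le_of_eq ?_)
  refine Fintype.sum_equiv (signMulEquiv fun i => decide (s i = 1)) _ _ fun ω => ?_
  congr 2
  refine Finset.sum_congr rfl fun i _ => ?_
  have hsi : s i = 1 ∨ s i = -1 := by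
    have := hs i (Set.mem_univ i)
    simpa [or_comm] using this
  simp only [signMulEquiv, Equiv.coe_fn_mk]
  rw [boolSign_beq, boolSign_decide hsi, smul_smul]

theorem sum_enorm_rpow_le_of_abs_le {p : ℝ} (hp : 1 ≤ p) (x : ι → E) {a b : ι → ℝ}
    (hab : ∀ i, |a i| ≤ |b i|) :
    ∑ ω : ι → Bool, ‖∑ i, (boolSign (ω i) * a i) • x i‖ₑ ^ p ≤
      ∑ ω : ι → Bool, ‖∑ i, (boolSign (ω i) * b i) • x i‖ₑ ^ p := by
  have h : ∀ v : E, ‖v‖ₑ ^ p = ENNReal.ofReal (‖v‖ ^ p) := fun v => by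
    rw [← ofReal_norm, ENNReal.ofReal_rpow_of_nonneg (norm_nonneg _) (by linarith)]
  simp only [h]
  rw [← ENNReal.ofReal_sum_of_nonneg fun _ _ => by positivity,
    ← ENNReal.ofReal_sum_of_nonneg fun _ _ => by positivity]
  exact ENNReal.ofReal_le_ofReal (sum_norm_rpow_le_of_abs_le hp x hab)

end Contraction

/-! ### Norms of randomized sums -/

theorem eLpNorm_ofReal_rpow {S E : Type*} [MeasurableSpace S] [NormedAddCommGroup E] {p : ℝ}
    (hp : 0 < p) (ν : Measure S) (f : S → E) :
    eLpNorm f (ENNReal.ofReal p) ν ^ p = ∫⁻ s, ‖f s‖ₑ ^ p ∂ν := by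
  rw [eLpNorm_eq_lintegral_rpow_enorm_toReal (by simpa using hp) ENNReal.ofReal_ne_top,
    ENNReal.toReal_ofReal hp.le, ← ENNReal.rpow_mul, one_div_mul_cancel hp.ne', ENNReal.rpow_one]

theorem measurable_boolSign_eval {X ι : Type*} [MeasurableSpace X] (i : ι) :
    Measurable fun s : X × (ι → Bool) => boolSign (s.2 i) :=
  (measurable_of_finite boolSign).comp ((measurable_pi_apply i).comp measurable_snd)

theorem stronglyMeasurable_sum_smul {S ι E : Type*} [MeasurableSpace S] [Fintype ι]
    [NormedAddCommGroup E] [NormedSpace ℝ E] {f : ι → S → ℝ}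
    (hf : ∀ i, Measurable (f i)) (x : ι → E) : StronglyMeasurable fun s => ∑ i, f i s • x i :=
  Finset.stronglyMeasurable_fun_sum _ fun i _ => (hf i).stronglyMeasurable.smul_const (x i)

theorem lintegral_prod_count {X ι : Type*} [MeasurableSpace X] [Fintype ι]
    [DecidableEq ι] (μ : Measure X) [SigmaFinite μ] {f : X × (ι → Bool) → ℝ≥0∞}
    (hf : Measurable f) :
    ∫⁻ s, f s ∂(μ.prod Measure.count) = ∑ ω : ι → Bool, ∫⁻ y, f (y, ω) ∂μ := by
  rw [lintegral_prod_symm _ hf.aemeasurable, lintegral_count, tsum_fintype]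

theorem eLpNorm_prod_count_rpow {X ι E : Type*} [MeasurableSpace X] [Fintype ι] [DecidableEq ι]
    [NormedAddCommGroup E] {p : ℝ} (hp : 0 < p) (μ : Measure X) [SigmaFinite μ]
    {f : X × (ι → Bool) → E} (hf : StronglyMeasurable f) :
    eLpNorm f (ENNReal.ofReal p) (μ.prod Measure.count) ^ p =
      ∑ ω : ι → Bool, eLpNorm (fun y => f (y, ω)) (ENNReal.ofReal p) μ ^ p := by
  simp only [eLpNorm_ofReal_rpow hp]
  exact lintegral_prod_count μ (hf.enorm.pow_const p)

section SignNorm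

variable {X : Type*} [MeasurableSpace X] {ι : Type*} [Fintype ι] [DecidableEq ι]
  {E : Type*} [NormedAddCommGroup E] [NormedSpace ℝ E]

/-- The `L^p` norm of `∑ i, ε i a i x i` on the product of `X` with the space of all sign vectors,
which carries the counting measure. -/
noncomputable def signNorm (p : ℝ) (μ : Measure X) (a : ι → X → ℝ) (x : ι → E) : ℝ≥0∞ :=
  eLpNorm (fun s : X × (ι → Bool) => ∑ i, (boolSign (s.2 i) * a i s.1) • x i) (ENNReal.ofReal p)
    (μ.prod Measure.count)

theorem signNorm_rpow {p : ℝ} (hp : 0 < p) (μ : Measure X) [SigmaFinite μ] {a : ι → X → ℝ}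
    (ha : ∀ i, Measurable (a i)) (x : ι → E) :
    signNorm p μ a x ^ p = ∑ ω : ι → Bool,
      eLpNorm (fun y => ∑ i, (boolSign (ω i) * a i y) • x i) (ENNReal.ofReal p) μ ^ p :=
  eLpNorm_prod_count_rpow hp μ (stronglyMeasurable_sum_smul (fun i =>
    (measurable_boolSign_eval i).mul ((ha i).comp measurable_fst)) x)

theorem signNorm_mono {p : ℝ} (hp : 1 ≤ p) (μ : Measure X) [SigmaFinite μ] {a b : ι → X → ℝ}
    (ha : ∀ i, Measurable (a i)) (hb : ∀ i, Measurable (b i))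
    (hab : ∀ i y, |a i y| ≤ |b i y|) (x : ι → E) : signNorm p μ a x ≤ signNorm p μ b x := by
  have hp0 : 0 < p := by linarith
  have hm : ∀ {c : ι → X → ℝ}, (∀ i, Measurable (c i)) → ∀ ω : ι → Bool,
      Measurable fun y => ‖∑ i, (boolSign (ω i) * c i y) • x i‖ₑ ^ p := fun hc ω =>
    ((stronglyMeasurable_sum_smul (fun i => (hc i).const_mul _) x).enorm).pow_const p
  rw [← ENNReal.rpow_le_rpow_iff hp0, signNorm_rpow hp0 μ ha, signNorm_rpow hp0 μ hb]
  simp only [eLpNorm_ofReal_rpow hp0]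
  rw [← lintegral_finsetSum _ fun ω _ => hm ha ω, ← lintegral_finsetSum _ fun ω _ => hm hb ω]
  exact lintegral_mono fun y => sum_enorm_rpow_le_of_abs_le hp x fun i => hab i y

theorem signNorm_le_mul {p : ℝ} (hp : 1 ≤ p) (μ : Measure X) [SigmaFinite μ] {a b : ι → X → ℝ}
    (ha : ∀ i, Measurable (a i)) (hb : ∀ i, Measurable (b i)) (c : ℝ≥0)
    (hab : ∀ i y, |a i y| ≤ c * |b i y|) (x : ι → E) :
    signNorm p μ a x ≤ c * signNorm p μ b x := by
  have h1 : signNorm p μ a x ≤ signNorm p μ (fun i y => (c : ℝ) * b i y) x :=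
    signNorm_mono hp μ ha (fun i => (hb i).const_mul _)
      (fun i y => by rw [abs_mul, NNReal.abs_eq]; exact hab i y) x
  refine h1.trans (le_of_eq ?_)
  have h2 : (fun s : X × (ι → Bool) => ∑ i, (boolSign (s.2 i) * ((c : ℝ) * b i s.1)) • x i)
      = (c : ℝ) • fun s : X × (ι → Bool) => ∑ i, (boolSign (s.2 i) * b i s.1) • x i := by
    ext s
    simp only [Pi.smul_apply, Finset.smul_sum, smul_smul]
    refine Finset.sum_congr rfl fun i _ => ?_
    ring_nf
  rw [signNorm, signNorm, h2, eLpNorm_const_smul]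
  simp

end SignNorm

/-! ### Unconditionality for adapted families of atoms -/

/-- The σ-algebra of the measurable sets that do not split any member of `𝒜`: each `A ∈ 𝒜` lies
inside the set or is disjoint from it. -/
@[reducible] def unsplitAlgebra {S : Type*} [MeasurableSpace S] (𝒜 : Set (Set S)) :
    MeasurableSpace S where
  MeasurableSet' G := MeasurableSet G ∧ ∀ A ∈ 𝒜, A ⊆ G ∨ Disjoint A G
  measurableSet_empty := ⟨MeasurableSet.empty, fun _ _ => Or.inr (Set.disjoint_empty _)⟩
  measurableSet_compl G hG := ⟨hG.1.compl, fun A hA => (hG.2 A hA).symm.imp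
    (fun h => h.subset_compl_right) fun h => Set.disjoint_compl_right_iff_subset.2 h⟩
  measurableSet_iUnion G hG := by
    refine ⟨MeasurableSet.iUnion fun n => (hG n).1, fun A hA => ?_⟩
    by_cases h : ∃ n, A ⊆ G n
    · obtain ⟨n, hn⟩ := h
      exact Or.inl (hn.trans (Set.subset_iUnion G n))
    · push Not at h
      exact Or.inr (Set.disjoint_iUnion_right.2 fun n => ((hG n).2 A hA).resolve_left (h n))

theorem measurable_unsplitAlgebra {S : Type*} [MeasurableSpace S] {𝒜 : Set (Set S)} {f : S → ℝ}
    (hf : Measurable f) (hc : ∀ A ∈ 𝒜, ∀ s ∈ A, ∀ t ∈ A, f s = f t) :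
    Measurable[unsplitAlgebra 𝒜] f := by
  intro B hB
  refine ⟨hf hB, fun A hA => ?_⟩
  by_cases h : ∃ s ∈ A, f s ∈ B
  · obtain ⟨s, hs, hsB⟩ := h
    refine Or.inl fun t ht => ?_
    rw [Set.mem_preimage, hc A hA t ht s hs]
    exact hsB
  · push Not at h
    exact Or.inr (Set.disjoint_left.2 fun t ht htB => h t ht htB)

/-- Unconditionality for functions `f i` that are adapted to families `𝒜 i` of sets: `f i` is
constant on the members of the later families, and has integral zero over each set that splits no
member of the families from `i` on. The filtration behind it consists of the
`unsplitAlgebra`s of the tails of `𝒜`; the countable family `T` makes it σ-finite. -/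
theorem HasUMDConstant.eLpNorm_sum_le {E : Type v} [NormedAddCommGroup E] [NormedSpace ℝ E]
    [CompleteSpace E] {p B : ℝ} (hB : HasUMDConstant.{u, v} E p B) {S : Type u} [MeasurableSpace S]
    {ν : Measure S} {ι : Type*} [Fintype ι] [LinearOrder ι] (𝒜 : ι → Set (Set S))
    {f : ι → S → ℝ} (hfm : ∀ i, Measurable (f i)) (hfp : ∀ i, MemLp (f i) (ENNReal.ofReal p) ν)
    (hconst : ∀ i j, i < j → ∀ A ∈ 𝒜 j, ∀ s ∈ A, ∀ t ∈ A, f i s = f i t)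
    (hzero : ∀ i G, MeasurableSet G → (∀ j, i ≤ j → ∀ A ∈ 𝒜 j, A ⊆ G ∨ Disjoint A G) →
      ν G < ∞ → ∫ s in G, f i s ∂ν = 0)
    {T : Set (Set S)} (hT : T.Countable) (hTm : ∀ G ∈ T, MeasurableSet G)
    (hTν : ∀ G ∈ T, ν G < ∞) (hTU : ⋃₀ T = Set.univ)
    (hTA : ∀ G ∈ T, ∀ i, ∀ A ∈ 𝒜 i, A ⊆ G ∨ Disjoint A G) (x : ι → E) {σ : ι → ℝ}
    (hσ : ∀ i, σ i = 1 ∨ σ i = -1) :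
    eLpNorm (fun s => ∑ i, (σ i * f i s) • x i) (ENNReal.ofReal p) ν ≤
      ENNReal.ofReal B * eLpNorm (fun s => ∑ i, f i s • x i) (ENNReal.ofReal p) ν := by
  let e : Fin (Fintype.card ι) ≃o ι := monoEquivOfFin ι rfl
  let 𝓑 : ℕ → Set (Set S) := fun n => {A | ∃ j, n ≤ (e.symm j : ℕ) ∧ A ∈ 𝒜 j}
  let 𝓕 : Filtration (Fin (Fintype.card ι + 1)) (inferInstance : MeasurableSpace S) :=
    { seq := fun n => unsplitAlgebra (𝓑 n)
      mono' := fun m n hmn G hG => ⟨hG.1, fun A ⟨j, hj, hA⟩ =>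
        hG.2 A ⟨j, le_trans (Fin.le_def.1 hmn) hj, hA⟩⟩
      le' := fun n G hG => hG.1 }
  have hmds : IsLpMartingaleDifference p ν 𝓕 fun k s => f (e k) s • x (e k) := by
    refine ⟨fun n => ?_, fun k => ?_, fun k => ?_, fun k G hG hνG => ?_⟩
    · have hTn : ∀ G ∈ T, MeasurableSet[𝓕 n] G := fun G hG =>
        ⟨hTm G hG, fun A ⟨j, _, hA⟩ => hTA G hG j A hA⟩
      refine Measure.sigmaFinite_of_countable hT (fun G hG => ?_) hTU
      rw [trim_measurableSet_eq _ (hTn G hG)]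
      exact hTν G hG
    · exact (hfp (e k)).of_le_mul (c := ‖x (e k)‖) ((hfp (e k)).1.smul_const _)
        (ae_of_all _ fun s => by rw [norm_smul, mul_comm])
    · have : Measurable[𝓕 k.succ] (f (e k)) := by
        refine measurable_unsplitAlgebra (hfm _) ?_
        rintro A ⟨j, hj, hA⟩
        refine hconst _ j ?_ A hA
        rw [← e.lt_symm_apply, Fin.lt_def]
        simpa [Nat.succ_le_iff] using hj
      exact this.stronglyMeasurable.smul_const _
    · rw [integral_smul_const, hzero (e k) G hG.1 _ hνG, zero_smul]
      intro j hj A hA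
      refine hG.2 A ⟨j, ?_, hA⟩
      rw [← e.le_symm_apply, Fin.le_def] at hj
      simpa using hj
  have key := hB S _ ν _ 𝓕 _ hmds (fun k => σ (e k)) fun k => hσ _
  have h1 : ∀ g : ι → E, ∑ k, g (e k) = ∑ i, g i := fun g => e.toEquiv.sum_comp g
  refine le_trans (le_of_eq ?_) (key.trans (le_of_eq ?_))
  · congr 1
    ext s
    simp only [smul_smul]
    exact (h1 fun i => (σ i * f i s) • x i).symm
  · congr 2
    ext s
    exact h1 fun i => f i s • x i

/-! ### Stein's inequality for averages over nested sets -/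

theorem memLp_of_abs_le_of_support {S : Type*} [MeasurableSpace S] {ν : Measure S} {q : ℝ≥0∞}
    {f : S → ℝ} (hf : Measurable f) {A : Set S} (hA : MeasurableSet A) (hν : ν A ≠ ∞) {M : ℝ}
    (hM : ∀ s, |f s| ≤ M) (h0 : ∀ s, s ∉ A → f s = 0) : MemLp f q ν := by
  refine (memLp_indicator_const q hA M (Or.inr hν)).mono' hf.aestronglyMeasurable
    (ae_of_all _ fun s => ?_)
  by_cases hs : s ∈ A
  · simpa [hs] using hM s
  · simp [hs, h0 s hs]

section Stein

variable {X : Type u} [MeasurableSpace X] {ι : Type u} [Fintype ι] [LinearOrder ι]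

/-- Fubini for `ε i φ` over a set `G` which, above `Q`, is a product `Q ×ˢ H`. -/
theorem setIntegral_boolSign_mul {μ : Measure X} [SigmaFinite μ] {Q : Set X} {φ : X → ℝ}
    (hφ : Integrable φ μ) (h0 : ∀ y, y ∉ Q → φ y = 0) (i : ι) {G : Set (X × (ι → Bool))}
    (hG : MeasurableSet G) {H : Set (ι → Bool)} [DecidablePred (· ∈ H)]
    (hGH : ∀ y ∈ Q, ∀ ω, (y, ω) ∈ G ↔ ω ∈ H) :
    ∫ s in G, boolSign (s.2 i) * φ s.1 ∂(μ.prod Measure.count) =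
      ∑ ω : ι → Bool, if ω ∈ H then boolSign (ω i) * ∫ y, φ y ∂μ else 0 := by
  have hint : Integrable (fun s : X × (ι → Bool) => boolSign (s.2 i) * φ s.1)
      (μ.prod Measure.count) := by
    have h := hφ.mul_prod (Integrable.of_finite (μ := Measure.count)
      (f := fun ω : ι → Bool => boolSign (ω i)))
    simpa only [mul_comm] using h
  rw [← integral_indicator hG, integral_prod_symm _ (hint.indicator hG), integral_fintype
    Integrable.of_finite]
  refine Finset.sum_congr rfl fun ω _ => ?_
  have hω : ∀ y, G.indicator (fun s : X × (ι → Bool) => boolSign (s.2 i) * φ s.1) (y, ω)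
      = if ω ∈ H then boolSign (ω i) * φ y else 0 := by
    intro y
    by_cases hy : y ∈ Q
    · simp only [Set.indicator, hGH y hy ω]
    · simp [Set.indicator, h0 y hy]
  simp only [hω]
  split_ifs <;> simp [integral_const_mul]

/-- A set of sign vectors that does not depend on the `i`-th sign sees that sign average out. -/
theorem sum_boolSign_eq_zero (i : ι) {H : Set (ι → Bool)} [DecidablePred (· ∈ H)]
    (hH : ∀ ω ω' : ι → Bool, (∀ l, l ≠ i → ω l = ω' l) → (ω ∈ H ↔ ω' ∈ H)) (c : ℝ) :
    ∑ ω : ι → Bool, (if ω ∈ H then boolSign (ω i) * c else 0) = 0 := by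
  have h := Fintype.sum_equiv (signMulEquiv fun l => decide (l ≠ i))
    (fun ω : ι → Bool => if ω ∈ H then boolSign (ω i) * c else 0)
    (fun ω => -(if ω ∈ H then boolSign (ω i) * c else 0)) fun ω => by
      have h1 : signMulEquiv (fun l => decide (l ≠ i)) ω ∈ H ↔ ω ∈ H :=
        hH _ _ fun l hl => by simp [signMulEquiv, hl]
      have h2 : signMulEquiv (fun l => decide (l ≠ i)) ω i = !(ω i) := by
        simp [signMulEquiv]
      simp only [h1, h2, boolSign_not]
      split_ifs <;> simp
  rw [Finset.sum_neg_distrib] at h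
  linarith

/-- The set of points of `Q k.1` together with the sign vectors that agree with `τ` in all signs
decided before step `k`; the `i`-th sign is decided at step `(i, false)`. -/
def signAtom (Q : ι → Set X) (k : ι ×ₗ Bool) (τ : ι → Bool) : Set (X × (ι → Bool)) :=
  {s | s.1 ∈ Q (ofLex k).1 ∧ ∀ l, toLex (l, false) < k → s.2 l = τ l}

/-- A form of Stein's inequality for the averages of `g i` over `Q i`. The functions
`ε i c i 1_{Q i}` and `ε i (g i - c i 1_{Q i})`, taken alternately, form a martingale difference
sequence; changing the signs of the latter and adding leaves twice the sum of the former. -/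
theorem signNorm_indicator_average_le {E : Type v} [NormedAddCommGroup E] [NormedSpace ℝ E]
    [CompleteSpace E] {p B : ℝ} (hp : 1 ≤ p) (hB : HasUMDConstant.{u, v} E p B) {μ : Measure X}
    [SigmaFinite μ] {Q : ι → Set X} (hQm : ∀ i, MeasurableSet (Q i)) (hQμ : ∀ i, μ (Q i) < ∞)
    (hQ : ∀ i j, i < j → Q j ⊆ Q i ∨ Disjoint (Q j) (Q i))
    {g : ι → X → ℝ} (hgm : ∀ i, Measurable (g i)) (hg0 : ∀ i y, y ∉ Q i → g i y = 0)
    (hgb : ∀ i, ∃ M, ∀ y, |g i y| ≤ M)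
    (hconst : ∀ i j, i < j → ∀ y ∈ Q j, ∀ z ∈ Q j, g i y = g i z)
    {c : ι → ℝ} (hc : ∀ i, ∫ y, g i y ∂μ = c i * μ.real (Q i))
    {T : Set (Set X)} (hT : T.Countable) (hTm : ∀ G ∈ T, MeasurableSet G)
    (hTμ : ∀ G ∈ T, μ G < ∞) (hTU : ⋃₀ T = Set.univ)
    (hTQ : ∀ G ∈ T, ∀ i, Q i ⊆ G ∨ Disjoint (Q i) G) (x : ι → E) :
    signNorm p μ (fun i => (Q i).indicator fun _ => c i) x ≤
      (1 + ENNReal.ofReal B) * signNorm p μ g x := by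
  classical
  let φ : ι ×ₗ Bool → X → ℝ := fun k y =>
    if (ofLex k).2 then g (ofLex k).1 y - (Q (ofLex k).1).indicator (fun _ => c (ofLex k).1) y
    else (Q (ofLex k).1).indicator (fun _ => c (ofLex k).1) y
  have hφt : ∀ i y, φ (toLex (i, true)) y = g i y - (Q i).indicator (fun _ => c i) y :=
    fun i y => by simp [φ]
  have hφf : ∀ i y, φ (toLex (i, false)) y = (Q i).indicator (fun _ => c i) y :=
    fun i y => by simp [φ]
  have him : ∀ i, Measurable ((Q i).indicator fun _ => c i) := fun i =>
    measurable_const.indicator (hQm i)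
  have hφm : ∀ k, Measurable (φ k) := by
    rintro ⟨i, _ | _⟩
    · change Measurable (φ (toLex (i, false)))
      rw [funext (hφf i)]
      exact him i
    · change Measurable (φ (toLex (i, true)))
      rw [funext (hφt i)]
      exact (hgm i).sub (him i)
  have hφ0 : ∀ k y, y ∉ Q (ofLex k).1 → φ k y = 0 := by
    intro k y hy
    simp [φ, hy, hg0]
  have hφb : ∀ k, ∃ M, ∀ y, |φ k y| ≤ M := by
    intro k
    obtain ⟨M, hM⟩ := hgb (ofLex k).1
    have hi : ∀ y, |(Q (ofLex k).1).indicator (fun _ => c (ofLex k).1) y| ≤ |c (ofLex k).1| := by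
      intro y
      by_cases hy : y ∈ Q (ofLex k).1 <;> simp [hy]
    refine ⟨M + |c (ofLex k).1|, fun y => ?_⟩
    simp only [φ]
    split_ifs
    · exact (abs_sub _ _).trans (add_le_add (hM y) (hi y))
    · exact (hi y).trans (le_add_of_nonneg_left ((abs_nonneg _).trans (hM y)))
  have hφi : ∀ k, Integrable (φ k) μ := fun k => by
    obtain ⟨M, hM⟩ := hφb k
    exact memLp_one_iff_integrable.1
      (memLp_of_abs_le_of_support (hφm k) (hQm _) (hQμ _).ne hM (hφ0 k))
  -- the martingale differences, with two steps for each `i`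
  let F : ι ×ₗ Bool → X × (ι → Bool) → ℝ := fun k s => boolSign (s.2 (ofLex k).1) * φ k s.1
  have hFm : ∀ k, Measurable (F k) := fun k =>
    (measurable_boolSign_eval _).mul ((hφm k).comp measurable_fst)
  have hFp : ∀ k, MemLp (F k) (ENNReal.ofReal p) (μ.prod Measure.count) := fun k => by
    obtain ⟨M, hM⟩ := hφb k
    refine memLp_of_abs_le_of_support (A := Q (ofLex k).1 ×ˢ Set.univ) (M := M) (hFm k)
      ((hQm _).prod MeasurableSet.univ) ?_ (fun s => ?_) fun s hs => ?_
    · rw [Measure.prod_prod]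
      exact ENNReal.mul_ne_top (hQμ _).ne (measure_ne_top _ _)
    · rw [abs_mul]
      rcases boolSign_eq (s.2 (ofLex k).1) with h | h <;> simpa [h] using hM s.1
    · have : s.1 ∉ Q (ofLex k).1 := fun h => hs ⟨h, Set.mem_univ _⟩
      simp [F, hφ0 k _ this]
  have hFconst : ∀ k k', k < k' → ∀ A ∈ Set.range (signAtom Q k'), ∀ s ∈ A, ∀ t ∈ A,
      F k s = F k t := by
    rintro ⟨i, b⟩ ⟨j, b'⟩ hk _ ⟨τ, rfl⟩ s ⟨hs1, hs2⟩ t ⟨ht1, ht2⟩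
    have hle : toLex (i, false) ≤ toLex (i, b) := by
      rw [Prod.Lex.le_iff]
      exact Or.inr ⟨rfl, Bool.false_le b⟩
    have hsign : s.2 i = t.2 i := (hs2 i (hle.trans_lt hk)).trans (ht2 i (hle.trans_lt hk)).symm
    have hval : φ (toLex (i, b)) s.1 = φ (toLex (i, b)) t.1 := by
      change s.1 ∈ Q j at hs1
      change t.1 ∈ Q j at ht1
      have hk' : i < j ∨ i = j ∧ b < b' := Prod.Lex.lt_iff.1 hk
      rcases hk' with hij | ⟨rfl, hb⟩
      · have h1 := hconst i j hij _ hs1 _ ht1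
        have h2 : s.1 ∈ Q i ↔ t.1 ∈ Q i := by
          rcases hQ i j hij with h | h
          · exact ⟨fun _ => h ht1, fun _ => h hs1⟩
          · exact ⟨fun h' => (Set.disjoint_left.1 h hs1 h').elim,
              fun h' => (Set.disjoint_left.1 h ht1 h').elim⟩
        have h3 : (Q i).indicator (fun _ => c i) s.1 = (Q i).indicator (fun _ => c i) t.1 := by
          by_cases h : t.1 ∈ Q i
          · rw [Set.indicator_of_mem h, Set.indicator_of_mem (h2.2 h)]
          · rw [Set.indicator_of_notMem h, Set.indicator_of_notMem (h2.not.2 h)]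
        cases b
        · rw [hφf, hφf, h3]
        · rw [hφt, hφt, h1, h3]
      · have hbf : b = false := by
          cases b
          · rfl
          · exact absurd hb (by simp)
        subst hbf
        simp [hφf, hs1, ht1]
    change boolSign (s.2 i) * φ (toLex (i, b)) s.1 = boolSign (t.2 i) * φ (toLex (i, b)) t.1
    rw [hsign, hval]
  have hFzero : ∀ k G, MeasurableSet G →
      (∀ k', k ≤ k' → ∀ A ∈ Set.range (signAtom Q k'), A ⊆ G ∨ Disjoint A G) →
      μ.prod Measure.count G < ∞ → ∫ s in G, F k s ∂(μ.prod Measure.count) = 0 := by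
    rintro k G hG hsplit -
    -- above `Q i`, the set `G` is a product with a set `H` of sign vectors, and `H` depends only on
    -- the signs decided before step `k`
    let H : Set (ι → Bool) := {ω | ∃ y ∈ Q (ofLex k).1, (y, ω) ∈ G}
    have hsat : ∀ y ∈ Q (ofLex k).1, ∀ z ∈ Q (ofLex k).1, ∀ ω ω' : ι → Bool,
        (∀ l, toLex (l, false) < k → ω l = ω' l) → (y, ω) ∈ G → (z, ω') ∈ G := by
      intro y hy z hz ω ω' hω hyG
      rcases hsplit k le_rfl _ ⟨ω', rfl⟩ with h | h
      · exact h ⟨hz, fun _ _ => rfl⟩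
      · exact (Set.disjoint_left.1 h ⟨hy, hω⟩ hyG).elim
    have hGH : ∀ y ∈ Q (ofLex k).1, ∀ ω, (y, ω) ∈ G ↔ ω ∈ H := fun y hy ω =>
      ⟨fun h => ⟨y, hy, h⟩, fun ⟨z, hz, h⟩ => hsat z hz y hy ω ω (fun _ _ => rfl) h⟩
    refine (setIntegral_boolSign_mul (hφi k) (hφ0 k) (ofLex k).1 hG hGH).trans ?_
    obtain ⟨i, _ | _⟩ := k
    · refine sum_boolSign_eq_zero i (fun ω ω' hω => ?_) _
      have hω' : ∀ l, toLex (l, false) < toLex (i, false) → ω l = ω' l := by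
        intro l hl
        refine hω l ?_
        rintro rfl
        exact lt_irrefl _ hl
      exact ⟨fun ⟨y, hy, h⟩ => ⟨y, hy, hsat y hy y hy _ _ hω' h⟩,
        fun ⟨y, hy, h⟩ => ⟨y, hy, hsat y hy y hy _ _ (fun l hl => (hω' l hl).symm) h⟩⟩
    · have : ∫ y, φ (toLex (i, true)) y ∂μ = 0 := by
        have hgi : Integrable (g i) μ := by
          obtain ⟨M, hM⟩ := hgb i
          exact memLp_one_iff_integrable.1
            (memLp_of_abs_le_of_support (hgm i) (hQm _) (hQμ _).ne hM (hg0 i))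
        have hii : Integrable ((Q i).indicator fun _ => c i) μ := by
          have h := hφi (toLex (i, false))
          rwa [funext (hφf i)] at h
        simp only [hφt]
        rw [integral_sub hgi hii, hc,
          integral_indicator_const _ (hQm i), smul_eq_mul, mul_comm, sub_self]
      refine Finset.sum_eq_zero fun ω _ => ?_
      change (if ω ∈ H then boolSign (ω i) * ∫ y, φ (toLex (i, true)) y ∂μ else 0) = 0
      rw [this]
      simp
  have key := hB.eLpNorm_sum_le (fun k => Set.range (signAtom Q k)) hFm hFp hFconst hFzero
    (T := (fun G => G ×ˢ Set.univ) '' T) (hT.image _)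
    (by rintro _ ⟨G, hG, rfl⟩; exact (hTm G hG).prod MeasurableSet.univ)
    (by
      rintro _ ⟨G, hG, rfl⟩
      rw [Measure.prod_prod]
      exact ENNReal.mul_lt_top (hTμ G hG) (measure_lt_top _ _))
    (by
      refine Set.eq_univ_of_forall fun s => ?_
      obtain ⟨G, hG, hs⟩ := Set.mem_sUnion.1 (hTU.symm ▸ Set.mem_univ s.1)
      exact ⟨_, ⟨G, hG, rfl⟩, hs, Set.mem_univ _⟩)
    (by
      rintro _ ⟨G, hG, rfl⟩ k _ ⟨τ, rfl⟩
      rcases hTQ G hG (ofLex k).1 with h | h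
      · exact Or.inl fun s hs => ⟨h hs.1, Set.mem_univ _⟩
      · exact Or.inr (Set.disjoint_left.2 fun s hs hs' => Set.disjoint_left.1 h hs.1 hs'.1))
    (fun k => x (ofLex k).1) (σ := fun k => if (ofLex k).2 then -1 else 1)
    (fun k => by by_cases h : (ofLex k).2 <;> simp [h])
  have hsum : ∀ w : ι ×ₗ Bool → E,
      ∑ k, w k = ∑ i, (w (toLex (i, false)) + w (toLex (i, true))) := by
    intro w
    rw [← (toLex : ι × Bool ≃ ι ×ₗ Bool).sum_comp, Fintype.sum_prod_type]
    exact Finset.sum_congr rfl fun i _ => by rw [Fintype.sum_bool, add_comm]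
  have hsumF : ∀ s : X × (ι → Bool), ∑ k, F k s • x (ofLex k).1
      = ∑ i, (boolSign (s.2 i) * g i s.1) • x i := by
    intro s
    rw [hsum]
    refine Finset.sum_congr rfl fun i _ => ?_
    simp only [F, ofLex_toLex, hφf, hφt, ← add_smul]
    ring_nf
  have hsumσ : ∀ s : X × (ι → Bool),
      ∑ k : ι ×ₗ Bool, ((if (ofLex k).2 then -1 else 1) * F k s) • x (ofLex k).1
      = (2 : ℝ) • ∑ i, (boolSign (s.2 i) * (Q i).indicator (fun _ => c i) s.1) • x i
        - ∑ i, (boolSign (s.2 i) * g i s.1) • x i := by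
    intro s
    rw [hsum, Finset.smul_sum, ← Finset.sum_sub_distrib]
    refine Finset.sum_congr rfl fun i _ => ?_
    simp only [F, ofLex_toLex, hφf, hφt, ← add_smul, ← sub_smul, smul_smul]
    congr 1
    simp
    ring
  simp only [hsumF, hsumσ] at key
  set a : X × (ι → Bool) → E :=
    fun s => ∑ i, (boolSign (s.2 i) * (Q i).indicator (fun _ => c i) s.1) • x i with ha
  set b : X × (ι → Bool) → E := fun s => ∑ i, (boolSign (s.2 i) * g i s.1) • x i with hb
  have ham : StronglyMeasurable a := stronglyMeasurable_sum_smul (fun i =>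
    (measurable_boolSign_eval i).mul ((him i).comp measurable_fst)) x
  have hbm : StronglyMeasurable b := stronglyMeasurable_sum_smul (fun i =>
    (measurable_boolSign_eval i).mul ((hgm i).comp measurable_fst)) x
  have hp' : 1 ≤ ENNReal.ofReal p := by simpa using ENNReal.ofReal_le_ofReal hp
  change eLpNorm a _ _ ≤ _ * eLpNorm b _ _
  calc eLpNorm a (ENNReal.ofReal p) (μ.prod Measure.count)
      ≤ eLpNorm ((2 : ℝ) • a) (ENNReal.ofReal p) (μ.prod Measure.count) := by
        rw [eLpNorm_const_smul]
        refine le_mul_of_one_le_left' ?_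
        rw [← ofReal_norm]
        norm_num
    _ = eLpNorm ((fun s => (2 : ℝ) • a s - b s) + b) (ENNReal.ofReal p)
          (μ.prod Measure.count) := by
        congr 1
        ext s
        simp
    _ ≤ _ := eLpNorm_add_le ((ham.const_smul _).sub hbm).aestronglyMeasurable
        hbm.aestronglyMeasurable hp'
    _ ≤ ENNReal.ofReal B * eLpNorm b (ENNReal.ofReal p) (μ.prod Measure.count) +
          eLpNorm b (ENNReal.ofReal p) (μ.prod Measure.count) := by
        gcongr
    _ = _ := by ring

end Stein

/-! ### Dyadic cubes, doubling measures and Haar functions -/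

namespace DyadicSystem

variable {X : Type u} [MetricSpace X] [MeasurableSpace X] {δ : ℝ} (𝒟 : DyadicSystem X δ)

theorem subset_of_mem_of_mem {P R : 𝒟.Cube} (h : R.1 ≤ P.1) {y : X} (hP : y ∈ 𝒟.toSet P)
    (hR : y ∈ 𝒟.toSet R) : 𝒟.toSet P ⊆ 𝒟.toSet R := by
  obtain ⟨l, α⟩ := P
  obtain ⟨k, γ⟩ := R
  obtain ⟨m, hm⟩ := Int.le.dest h
  change k + (m : ℤ) = l at hm
  subst hm
  change y ∈ 𝒟.cube k γ at hR
  rw [𝒟.cube_eq_iUnion k γ m] at hR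
  obtain ⟨⟨b, hb⟩, hy⟩ := Set.mem_iUnion.1 hR
  have hba : b = α := by
    by_contra hne
    exact Set.disjoint_left.1 (𝒟.disjoint_cube _ b α hne) hy hP
  subst hba
  exact hb

theorem subset_or_disjoint {P R : 𝒟.Cube} (h : R.1 ≤ P.1) :
    𝒟.toSet P ⊆ 𝒟.toSet R ∨ Disjoint (𝒟.toSet P) (𝒟.toSet R) := by
  by_cases hy : ∃ y ∈ 𝒟.toSet P, y ∈ 𝒟.toSet R
  · obtain ⟨y, hP, hR⟩ := hy
    exact Or.inl (𝒟.subset_of_mem_of_mem h hP hR)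
  · push Not at hy
    exact Or.inr (Set.disjoint_left.2 hy)

theorem exists_mem_cube (k : ℤ) (y : X) : ∃ α, y ∈ 𝒟.cube k α :=
  Set.mem_iUnion.1 ((𝒟.iUnion_cube k).symm ▸ Set.mem_univ y)

theorem exists_isChild {Q : 𝒟.Cube} {y : X} (hy : y ∈ 𝒟.toSet Q) :
    ∃ R, 𝒟.IsChild R Q ∧ y ∈ 𝒟.toSet R := by
  obtain ⟨α, hα⟩ := 𝒟.exists_mem_cube (Q.1 + 1) y
  have hle : Q.1 ≤ (⟨Q.1 + 1, α⟩ : 𝒟.Cube).1 := (lt_add_one Q.1).le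
  exact ⟨⟨Q.1 + 1, α⟩, ⟨rfl, 𝒟.subset_of_mem_of_mem hle hα hy⟩, hα⟩

theorem disjoint_of_ne {P R : 𝒟.Cube} (h : P.1 = R.1) (hne : P ≠ R) :
    Disjoint (𝒟.toSet P) (𝒟.toSet R) := by
  obtain ⟨k, α⟩ := P
  obtain ⟨l, γ⟩ := R
  change k = l at h
  subst h
  exact 𝒟.disjoint_cube k α γ fun h => hne (by rw [h])

theorem measurableSet_toSet (Q : 𝒟.Cube) : MeasurableSet (𝒟.toSet Q) :=
  𝒟.measurableSet_cube _ _

theorem center_mem_toSet (hδ : 0 < δ) (Q : 𝒟.Cube) : (Q.2 : X) ∈ 𝒟.toSet Q :=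
  𝒟.ball_subset_cube _ _ (Metric.mem_ball_self (by positivity))

theorem countable_range_cube (k : ℤ) : (Set.range (𝒟.cube k)).Countable :=
  have := (𝒟.countable_centers k).to_subtype
  Set.countable_range _

theorem sUnion_range_cube (k : ℤ) : ⋃₀ Set.range (𝒟.cube k) = Set.univ := by
  rw [Set.sUnion_range, 𝒟.iUnion_cube]

/-- A function is measurable if it is constant on every cube of some level. -/
theorem measurable_of_const_on_cube {f : X → ℝ} (k : ℤ)
    (hf : ∀ α, ∀ y ∈ 𝒟.cube k α, ∀ z ∈ 𝒟.cube k α, f y = f z) : Measurable f := by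
  intro B _
  have h : f ⁻¹' B = ⋃ α : {α // 𝒟.cube k α ⊆ f ⁻¹' B}, 𝒟.cube k α := by
    refine Set.Subset.antisymm (fun y hy => ?_) (Set.iUnion_subset fun α => α.2)
    obtain ⟨α, hα⟩ := 𝒟.exists_mem_cube k y
    refine Set.mem_iUnion.2 ⟨⟨α, fun z hz => ?_⟩, hα⟩
    rw [Set.mem_preimage, hf α z hz y hα]
    exact hy
  rw [h]
  have := (𝒟.countable_centers k).to_subtype
  exact MeasurableSet.iUnion fun α => 𝒟.measurableSet_cube k α

end DyadicSystem

section Doubling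

variable {X : Type u} [MetricSpace X] [MeasurableSpace X] {μ : Measure X} {D : ℝ≥0} {δ : ℝ}

theorem IsDoublingMeasure.measure_ball_le (hμ : IsDoublingMeasure μ D) (z : X) (n : ℕ) {r : ℝ}
    (hr : 0 < r) : μ (Metric.ball z (2 ^ n * r)) ≤ (D ^ n : ℝ≥0) * μ (Metric.ball z r) := by
  induction n with
  | zero => simp
  | succ n ih =>
    calc μ (Metric.ball z (2 ^ (n + 1) * r)) = μ (Metric.ball z (2 * (2 ^ n * r))) := by ring_nf
      _ ≤ D * μ (Metric.ball z (2 ^ n * r)) := (hμ z _ (by positivity)).1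
      _ ≤ D * ((D ^ n : ℝ≥0) * μ (Metric.ball z r)) := by gcongr
      _ = (D ^ (n + 1) : ℝ≥0) * μ (Metric.ball z r) := by
        rw [← mul_assoc, ← ENNReal.coe_mul, pow_succ']

theorem IsDoublingMeasure.measure_toSet_lt_top (hμ : IsDoublingMeasure μ D) (hδ : 0 < δ)
    (𝒟 : DyadicSystem X δ) (Q : 𝒟.Cube) : μ (𝒟.toSet Q) < ∞ :=
  (measure_mono (𝒟.cube_subset_ball _ _)).trans_lt (hμ _ _ (by positivity)).2

theorem IsDoublingMeasure.sigmaFinite (hμ : IsDoublingMeasure μ D) (hδ : 0 < δ)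
    (𝒟 : DyadicSystem X δ) : SigmaFinite μ := by
  refine Measure.sigmaFinite_of_countable (𝒟.countable_range_cube 0) ?_ (𝒟.sUnion_range_cube 0)
  rintro _ ⟨α, rfl⟩
  exact hμ.measure_toSet_lt_top hδ 𝒟 ⟨0, α⟩

/-- A cube is contained in the ball of radius `6 δ ^ k` around the centre of any of its children,
which contains the ball of radius `δ ^ (k + 1) / 5` with the same centre. -/
theorem IsDoublingMeasure.measure_toSet_le (hμ : IsDoublingMeasure μ D) (hδ : 0 < δ)
    (𝒟 : DyadicSystem X δ) {Q R : 𝒟.Cube} (hR : 𝒟.IsChild R Q) {n : ℕ} (hn : 30 / δ ≤ 2 ^ n) :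
    μ (𝒟.toSet Q) ≤ (D ^ n : ℝ≥0) * μ (𝒟.toSet R) := by
  have hpos : 0 < 1 / 5 * δ ^ R.1 := by positivity
  have hsub : 𝒟.toSet Q ⊆ Metric.ball (R.2 : X) (2 ^ n * (1 / 5 * δ ^ R.1)) := by
    intro y hy
    have h1 : dist y (Q.2 : X) < 3 * δ ^ Q.1 := 𝒟.cube_subset_ball _ _ hy
    have h2 : dist (R.2 : X) (Q.2 : X) < 3 * δ ^ Q.1 :=
      𝒟.cube_subset_ball _ _ (hR.2 (𝒟.center_mem_toSet hδ R))
    have h3 : 6 * δ ^ Q.1 ≤ 2 ^ n * (1 / 5 * δ ^ R.1) := by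
      rw [hR.1, zpow_add_one₀ hδ.ne']
      have : 30 ≤ 2 ^ n * δ := (div_le_iff₀ hδ).1 hn
      have hq : 0 < δ ^ Q.1 := by positivity
      nlinarith
    rw [Metric.mem_ball]
    calc dist y (R.2 : X) ≤ dist y (Q.2 : X) + dist (R.2 : X) (Q.2 : X) := dist_triangle_right _ _ _
      _ < 6 * δ ^ Q.1 := by linarith
      _ ≤ _ := h3
  calc μ (𝒟.toSet Q) ≤ μ (Metric.ball (R.2 : X) (2 ^ n * (1 / 5 * δ ^ R.1))) := measure_mono hsub
    _ ≤ (D ^ n : ℝ≥0) * μ (Metric.ball (R.2 : X) (1 / 5 * δ ^ R.1)) := hμ.measure_ball_le _ n hpos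
    _ ≤ _ := by
      gcongr
      exact 𝒟.ball_subset_cube _ _

end Doubling

namespace HaarSystem

variable {X : Type u} [MetricSpace X] [MeasurableSpace X] {μ : Measure X} {δ : ℝ}
  {𝒟 : DyadicSystem X δ} (H : HaarSystem 𝒟 μ)

theorem apply_eq_zero (Q : 𝒟.Cube) (θ : Fin (H.n Q)) {y : X} (hy : y ∉ 𝒟.toSet Q) :
    H.h Q θ y = 0 := by
  by_contra h
  exact hy (H.support_subset Q θ h)

/-- A Haar function of `Q` is constant on every other cube whose level is not lower. -/
theorem eq_on_cube {Q P : 𝒟.Cube} (θ : Fin (H.n Q)) (hle : Q.1 ≤ P.1) (hne : P ≠ Q) {y z : X}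
    (hy : y ∈ 𝒟.toSet P) (hz : z ∈ 𝒟.toSet P) : H.h Q θ y = H.h Q θ z := by
  by_cases hd : Disjoint (𝒟.toSet P) (𝒟.toSet Q)
  · rw [H.apply_eq_zero Q θ (Set.disjoint_left.1 hd hy),
      H.apply_eq_zero Q θ (Set.disjoint_left.1 hd hz)]
  · have hPQ := (𝒟.subset_or_disjoint hle).resolve_right hd
    have hlt : Q.1 < P.1 := lt_of_le_of_ne hle fun h => hd (𝒟.disjoint_of_ne h.symm hne)
    obtain ⟨R, hR, hyR⟩ := 𝒟.exists_isChild (hPQ hy)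
    have hPR : 𝒟.toSet P ⊆ 𝒟.toSet R :=
      𝒟.subset_of_mem_of_mem (by rw [hR.1]; exact hlt) hy hyR
    obtain ⟨c, hc⟩ := H.const_on_child Q θ R hR
    rw [hc y hyR, hc z (hPR hz)]

theorem measurable_h (Q : 𝒟.Cube) (θ : Fin (H.n Q)) : Measurable (H.h Q θ) := by
  refine 𝒟.measurable_of_const_on_cube (Q.1 + 1) fun α y hy z hz => ?_
  refine H.eq_on_cube (P := ⟨Q.1 + 1, α⟩) θ (lt_add_one Q.1).le (fun h => ?_) hy hz
  have := congrArg Sigma.fst h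
  simp at this

theorem memLp_two (Q : 𝒟.Cube) (θ : Fin (H.n Q)) : MemLp (H.h Q θ) 2 μ :=
  ⟨(H.measurable_h Q θ).aestronglyMeasurable, by rw [H.norm_eq_one]; exact ENNReal.one_lt_top⟩

theorem integral_sq (Q : 𝒟.Cube) (θ : Fin (H.n Q)) : ∫ y, H.h Q θ y ^ 2 ∂μ = 1 := by
  have h := (H.memLp_two Q θ).eLpNorm_eq_integral_rpow_norm (by norm_num) (by norm_num)
  rw [H.norm_eq_one, eq_comm, ENNReal.ofReal_eq_one] at h
  simp only [ENNReal.toReal_ofNat, Real.norm_eq_abs] at h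
  have h2 : ∀ t : ℝ, |t| ^ (2 : ℝ) = t ^ 2 := fun t => by
    rw [← sq_abs, ← Real.rpow_natCast]; norm_num
  simp only [h2] at h
  rw [← Real.one_rpow (2⁻¹ : ℝ)] at h
  exact (Real.rpow_left_inj (integral_nonneg fun y => sq_nonneg _) zero_le_one (by norm_num)).1 h

theorem measureReal_toSet_pos (Q : 𝒟.Cube) (θ : Fin (H.n Q)) (hQ : μ (𝒟.toSet Q) < ∞) :
    0 < μ.real (𝒟.toSet Q) := by
  refine ENNReal.toReal_pos (fun h0 => ?_) hQ.ne
  have h1 : ∫ y in 𝒟.toSet Q, H.h Q θ y ^ 2 ∂μ = ∫ y, H.h Q θ y ^ 2 ∂μ :=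
    setIntegral_eq_integral_of_forall_compl_eq_zero fun y hy => by simp [H.apply_eq_zero Q θ hy]
  rw [Measure.restrict_eq_zero.2 h0, H.integral_sq] at h1
  simp at h1

variable {D : ℝ≥0}

theorem abs_h_le (hμ : IsDoublingMeasure μ D) (hδ : 0 < δ) {n : ℕ} (hn : 30 / δ ≤ 2 ^ n)
    (Q : 𝒟.Cube) (θ : Fin (H.n Q)) (y : X) :
    |H.h Q θ y| ≤
      √(D ^ n : ℝ≥0) * (𝒟.toSet Q).indicator (fun _ => (√(μ.real (𝒟.toSet Q)))⁻¹) y := by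
  by_cases hy : y ∈ 𝒟.toSet Q
  swap
  · simp [hy, H.apply_eq_zero Q θ hy]
  have hpos := H.measureReal_toSet_pos Q θ (hμ.measure_toSet_lt_top hδ 𝒟 Q)
  obtain ⟨R, hR, hyR⟩ := 𝒟.exists_isChild hy
  obtain ⟨c, hc⟩ := H.const_on_child Q θ R hR
  have h1 : c ^ 2 * μ.real (𝒟.toSet R) ≤ 1 := by
    rw [← H.integral_sq Q θ]
    calc c ^ 2 * μ.real (𝒟.toSet R) = ∫ z in 𝒟.toSet R, c ^ 2 ∂μ := by
          rw [setIntegral_const, smul_eq_mul, mul_comm]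
      _ = ∫ z in 𝒟.toSet R, H.h Q θ z ^ 2 ∂μ :=
          setIntegral_congr_fun (𝒟.measurableSet_toSet R) fun z hz => by simp only [hc z hz]
      _ ≤ _ := setIntegral_le_integral (H.memLp_two Q θ).integrable_sq
          (ae_of_all _ fun z => sq_nonneg _)
  have h2 : μ.real (𝒟.toSet Q) ≤ (D ^ n : ℝ≥0) * μ.real (𝒟.toSet R) := by
    have h := ENNReal.toReal_mono (ENNReal.mul_ne_top ENNReal.coe_ne_top
      (hμ.measure_toSet_lt_top hδ 𝒟 R).ne) (hμ.measure_toSet_le hδ 𝒟 hR hn)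
    rwa [ENNReal.toReal_mul, ENNReal.coe_toReal] at h
  rw [Set.indicator_of_mem hy, ← div_eq_mul_inv, ← Real.sqrt_div (NNReal.coe_nonneg _), hc y hyR]
  refine Real.abs_le_sqrt ((le_div_iff₀ hpos).2 ?_)
  calc c ^ 2 * μ.real (𝒟.toSet Q) ≤ c ^ 2 * ((D ^ n : ℝ≥0) * μ.real (𝒟.toSet R)) := by gcongr
    _ = (D ^ n : ℝ≥0) * (c ^ 2 * μ.real (𝒟.toSet R)) := by ring
    _ ≤ (D ^ n : ℝ≥0) := mul_le_of_le_one_right (NNReal.coe_nonneg _) h1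

theorem abs_h_le_const (hμ : IsDoublingMeasure μ D) (hδ : 0 < δ) {n : ℕ} (hn : 30 / δ ≤ 2 ^ n)
    (Q : 𝒟.Cube) (θ : Fin (H.n Q)) (y : X) :
    |H.h Q θ y| ≤ √(D ^ n : ℝ≥0) * (√(μ.real (𝒟.toSet Q)))⁻¹ := by
  refine (H.abs_h_le hμ hδ hn Q θ y).trans ?_
  gcongr
  exact Set.indicator_le_self' (fun _ _ => by positivity) y

theorem memLp_h (hμ : IsDoublingMeasure μ D) (hδ : 0 < δ) (q : ℝ≥0∞) (Q : 𝒟.Cube)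
    (θ : Fin (H.n Q)) : MemLp (H.h Q θ) q μ := by
  obtain ⟨n, hn⟩ := pow_unbounded_of_one_lt (30 / δ) (one_lt_two : (1 : ℝ) < 2)
  exact memLp_of_abs_le_of_support (H.measurable_h Q θ) (𝒟.measurableSet_toSet Q)
    (hμ.measure_toSet_lt_top hδ 𝒟 Q).ne (H.abs_h_le_const hμ hδ hn.le Q θ)
    fun y => H.apply_eq_zero Q θ

/-- The mean of `|h|` over `Q` is at least of the size `μ(Q)^{-1/2}`, because
`1 = ∫ h² ≤ ‖h‖_∞ ∫ |h|`. -/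
theorem inv_sqrt_le_average (hμ : IsDoublingMeasure μ D) (hδ : 0 < δ) {n : ℕ}
    (hn : 30 / δ ≤ 2 ^ n) (Q : 𝒟.Cube) (θ : Fin (H.n Q)) :
    (√(μ.real (𝒟.toSet Q)))⁻¹ ≤
      √(D ^ n : ℝ≥0) * ((∫ y, |H.h Q θ y| ∂μ) / μ.real (𝒟.toSet Q)) := by
  have hpos := H.measureReal_toSet_pos Q θ (hμ.measure_toSet_lt_top hδ 𝒟 Q)
  have hint : Integrable (fun y => |H.h Q θ y|) μ :=
    (memLp_one_iff_integrable.1 (H.memLp_h hμ hδ 1 Q θ)).abs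
  have h1 : 1 ≤ √(D ^ n : ℝ≥0) * (√(μ.real (𝒟.toSet Q)))⁻¹ * ∫ y, |H.h Q θ y| ∂μ := by
    rw [← H.integral_sq Q θ, ← integral_const_mul]
    refine integral_mono (H.memLp_two Q θ).integrable_sq (hint.const_mul _) fun y => ?_
    change H.h Q θ y ^ 2 ≤ _ * |H.h Q θ y|
    rw [← sq_abs, sq]
    gcongr
    exact H.abs_h_le_const hμ hδ hn Q θ y
  have hs : 0 < √(μ.real (𝒟.toSet Q)) := Real.sqrt_pos.2 hpos
  calc (√(μ.real (𝒟.toSet Q)))⁻¹ = (√(μ.real (𝒟.toSet Q)))⁻¹ * 1 := (mul_one _).symm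
    _ ≤ (√(μ.real (𝒟.toSet Q)))⁻¹ *
        (√(D ^ n : ℝ≥0) * (√(μ.real (𝒟.toSet Q)))⁻¹ * ∫ y, |H.h Q θ y| ∂μ) := by gcongr
    _ = √(D ^ n : ℝ≥0) * ((∫ y, |H.h Q θ y| ∂μ) /
        (√(μ.real (𝒟.toSet Q)) * √(μ.real (𝒟.toSet Q)))) := by
      field_simp
    _ = _ := by rw [Real.mul_self_sqrt hpos.le]

end HaarSystem

/-! ### Random signs -/

section RandomSigns

variable {Ω : Type w} [MeasurableSpace Ω] {P : Measure Ω} {ι : Type u} [Fintype ι]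
  {ε : ι → Ω → ℝ}

theorem IsRandomSigns.ae_eq_one_or [IsProbabilityMeasure P] (hε : IsRandomSigns ε P) :
    ∀ᵐ η ∂P, ∀ i, ε i η = 1 ∨ ε i η = -1 := by
  rw [ae_all_iff]
  intro i
  have hm : ∀ t : ℝ, MeasurableSet {η | ε i η = t} := fun t =>
    hε.measurable i (measurableSet_singleton t)
  have hd : Disjoint {η | ε i η = 1} {η | ε i η = -1} :=
    Set.disjoint_left.2 fun η (h : ε i η = 1) (h' : ε i η = -1) => by linarith
  have h : P ({η | ε i η = 1} ∪ {η | ε i η = -1}) = 1 := by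
    rw [measure_union hd (hm _), hε.prob_one, hε.prob_neg_one, ENNReal.add_halves]
  exact (mem_ae_iff_prob_eq_one ((hm _).union (hm _))).2 h

theorem IsRandomSigns.measure_eq_boolSign (hε : IsRandomSigns ε P) (ω : ι → Bool) :
    P {η | ∀ i, ε i η = boolSign (ω i)} = (1 / 2) ^ Fintype.card ι := by
  have h := hε.indep.measure_inter_preimage_eq_mul Finset.univ
    (sets := fun i => {boolSign (ω i)}) fun i _ => measurableSet_singleton _
  have hset : {η | ∀ i, ε i η = boolSign (ω i)}
      = ⋂ i ∈ Finset.univ, ε i ⁻¹' {boolSign (ω i)} := by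
    ext η; simp
  have hi : ∀ i, P (ε i ⁻¹' {boolSign (ω i)}) = 1 / 2 := by
    intro i
    rcases boolSign_eq (ω i) with h | h <;> rw [h]
    · exact hε.prob_one i
    · exact hε.prob_neg_one i
  rw [hset, h]
  simp [hi]

theorem IsRandomSigns.lintegral_eq_sum [DecidableEq ι] [IsProbabilityMeasure P]
    (hε : IsRandomSigns ε P) (Φ : (ι → ℝ) → ℝ≥0∞) :
    ∫⁻ η, Φ (fun i => ε i η) ∂P =
      (1 / 2) ^ Fintype.card ι * ∑ ω : ι → Bool, Φ fun i => boolSign (ω i) := by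
  let A : (ι → Bool) → Set Ω := fun ω => {η | ∀ i, ε i η = boolSign (ω i)}
  have hA : ∀ ω, MeasurableSet (A ω) := fun ω => by
    have : A ω = ⋂ i, ε i ⁻¹' {boolSign (ω i)} := by ext η; simp [A]
    rw [this]
    exact MeasurableSet.iInter fun i => hε.measurable i (measurableSet_singleton _)
  have hae : ∀ᵐ η ∂P, Φ (fun i => ε i η) =
      ∑ ω : ι → Bool, (A ω).indicator (fun _ => Φ fun i => boolSign (ω i)) η := by
    filter_upwards [hε.ae_eq_one_or] with η hη
    have h0 : ∀ i, boolSign (decide (ε i η = 1)) = ε i η := fun i => boolSign_decide (hη i)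
    rw [Finset.sum_eq_single fun i => decide (ε i η = 1)]
    · have hmem : η ∈ A fun i => decide (ε i η = 1) := fun i => (h0 i).symm
      rw [Set.indicator_of_mem hmem]
      simp only [h0]
    · intro ω _ hω
      refine Set.indicator_of_notMem (fun h => hω (funext fun i => ?_)) _
      rw [h i]
      cases ω i <;> norm_num [boolSign]
    · intro h
      exact absurd (Finset.mem_univ _) h
  rw [lintegral_congr_ae hae, lintegral_finsetSum _ fun ω _ => measurable_const.indicator (hA ω),
    Finset.mul_sum]
  refine Finset.sum_congr rfl fun ω _ => ?_
  rw [lintegral_indicator_const (hA ω), hε.measure_eq_boolSign, mul_comm]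

variable {X : Type u} [MeasurableSpace X] {E : Type v} [NormedAddCommGroup E] [NormedSpace ℝ E]

theorem IsRandomSigns.randomizedNorm_eq [DecidableEq ι] [IsProbabilityMeasure P]
    (hε : IsRandomSigns ε P) {p : ℝ} (hp : 0 < p) (μ : Measure X) [SigmaFinite μ] {b : ι → X → ℝ}
    (hb : ∀ i, Measurable (b i))
    (x : ι → E) :
    randomizedNorm p P μ (fun η y => ∑ i, ε i η • b i y • x i) =
      ((1 / 2) ^ Fintype.card ι) ^ (1 / p) * signNorm p μ b x := by
  have h := hε.lintegral_eq_sum fun t =>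
    eLpNorm (fun y => ∑ i, (t i * b i y) • x i) (ENNReal.ofReal p) μ ^ p
  simp only [smul_smul, randomizedNorm]
  rw [h, ← signNorm_rpow hp μ hb, ENNReal.mul_rpow_of_nonneg _ _ (by positivity),
    ← ENNReal.rpow_mul, mul_one_div_cancel hp.ne', ENNReal.rpow_one]

end RandomSigns

section SignSlices

variable {X : Type u} [MeasurableSpace X] {E : Type v} [NormedAddCommGroup E]
  {ι : Type*} [Fintype ι] [DecidableEq ι]

theorem eLpNorm_prod_count_le {p : ℝ} (hp : 0 < p) (μ : Measure X) [SigmaFinite μ]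
    {f g : X × (ι → Bool) → E} (hf : StronglyMeasurable f) (hg : StronglyMeasurable g) (B : ℝ≥0∞)
    (h : ∀ ω, eLpNorm (fun y => f (y, ω)) (ENNReal.ofReal p) μ ≤
      B * eLpNorm (fun y => g (y, ω)) (ENNReal.ofReal p) μ) :
    eLpNorm f (ENNReal.ofReal p) (μ.prod Measure.count) ≤
      B * eLpNorm g (ENNReal.ofReal p) (μ.prod Measure.count) := by
  rw [← ENNReal.rpow_le_rpow_iff hp, ENNReal.mul_rpow_of_nonneg _ _ hp.le,
    eLpNorm_prod_count_rpow hp μ hf, eLpNorm_prod_count_rpow hp μ hg, Finset.mul_sum]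
  refine Finset.sum_le_sum fun ω _ => ?_
  rw [← ENNReal.mul_rpow_of_nonneg _ _ hp.le]
  exact ENNReal.rpow_le_rpow (h ω) hp.le

/-- The factor compensates for the mass `2 ^ card ι` of the counting measure on sign vectors. -/
theorem eLpNorm_eq_mul_prod_count {p : ℝ} (hp : 0 < p) (μ : Measure X) [SigmaFinite μ]
    {f : X → E} (hf : StronglyMeasurable f) :
    eLpNorm f (ENNReal.ofReal p) μ = ((1 / 2) ^ Fintype.card ι) ^ (1 / p) *
      eLpNorm (fun s : X × (ι → Bool) => f s.1) (ENNReal.ofReal p) (μ.prod Measure.count) := by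
  refine (ENNReal.rpow_left_injective hp.ne') ?_
  simp only
  have h := eLpNorm_prod_count_rpow hp μ (f := fun s : X × (ι → Bool) => f s.1)
    (hf.comp_measurable measurable_fst)
  rw [ENNReal.mul_rpow_of_nonneg _ _ hp.le, h, ← ENNReal.rpow_mul,
    one_div_mul_cancel hp.ne', ENNReal.rpow_one]
  simp only
  rw [Finset.sum_const, Finset.card_univ,
    Fintype.card_fun, Fintype.card_bool, nsmul_eq_mul, ← mul_assoc]
  push_cast
  rw [← mul_pow, one_div, ENNReal.inv_mul_cancel (by norm_num) (by norm_num), one_pow, one_mul]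

end SignSlices

/-- No cube of a finite family is split by the cubes of a sufficiently low level. -/
theorem DyadicSystem.exists_range_cube_forall_subset_or_disjoint {X : Type u}
    [MetricSpace X] [MeasurableSpace X] {δ : ℝ} {ι : Type*} [Finite ι] (𝒟 : DyadicSystem X δ)
    (Q : ι → 𝒟.Cube) : ∃ k : ℤ, ∀ G ∈ Set.range (𝒟.cube k), ∀ i,
      𝒟.toSet (Q i) ⊆ G ∨ Disjoint (𝒟.toSet (Q i)) G := by
  obtain ⟨k, hk⟩ := (Set.finite_range fun i => (Q i).1).bddBelow
  refine ⟨k, ?_⟩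
  rintro _ ⟨α, rfl⟩ i
  exact 𝒟.subset_or_disjoint (R := ⟨k, α⟩) (hk ⟨i, rfl⟩)

/-! ### Comparison of Haar functions with normalized indicators -/

section Haar

variable {X : Type u} [MetricSpace X] [MeasurableSpace X] {μ : Measure X} {D : ℝ≥0} {δ : ℝ}
  {E : Type v} [NormedAddCommGroup E] [NormedSpace ℝ E] [CompleteSpace E]
  {𝒟 : DyadicSystem X δ} (H : HaarSystem 𝒟 μ) {ι : Type u} [Fintype ι] [LinearOrder ι]
  {Q : ι → 𝒟.Cube}

/-- Unconditionality of Haar functions of distinct cubes, listed by nondecreasing level. -/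
theorem HaarSystem.eLpNorm_sum_mul_le {p B : ℝ} (hB : HasUMDConstant.{u, v} E p B)
    (hμ : IsDoublingMeasure μ D) (hδ : 0 < δ) (hQ : Function.Injective Q)
    (hlev : Monotone fun i => (Q i).1) (θ : ∀ i, Fin (H.n (Q i))) (x : ι → E) {σ : ι → ℝ}
    (hσ : ∀ i, σ i = 1 ∨ σ i = -1) :
    eLpNorm (fun y => ∑ i, (σ i * H.h (Q i) (θ i) y) • x i) (ENNReal.ofReal p) μ ≤
      ENNReal.ofReal B *
        eLpNorm (fun y => ∑ i, H.h (Q i) (θ i) y • x i) (ENNReal.ofReal p) μ := by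
  obtain ⟨k, hk⟩ := 𝒟.exists_range_cube_forall_subset_or_disjoint Q
  refine hB.eLpNorm_sum_le (fun i => {𝒟.toSet (Q i)}) (fun i => H.measurable_h _ _)
    (fun i => H.memLp_h hμ hδ _ _ _) ?_ ?_ (𝒟.countable_range_cube k) ?_ ?_
    (𝒟.sUnion_range_cube k) ?_ x hσ
  · rintro i j hij _ rfl y hy z hz
    exact H.eq_on_cube (θ i) (hlev hij.le) (fun h => hij.ne' (hQ h)) hy hz
  · intro i G _ hG _
    rcases hG i le_rfl _ rfl with h | h
    · rw [setIntegral_eq_integral_of_forall_compl_eq_zero, H.integral_eq_zero]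
      exact fun y hy => H.apply_eq_zero _ _ fun h' => hy (h h')
    · exact setIntegral_eq_zero_of_forall_eq_zero fun y hy =>
        H.apply_eq_zero _ _ fun h' => Set.disjoint_left.1 h h' hy
  · rintro _ ⟨α, rfl⟩
    exact 𝒟.measurableSet_cube k α
  · rintro _ ⟨α, rfl⟩
    exact hμ.measure_toSet_lt_top hδ 𝒟 ⟨k, α⟩
  · rintro G hG i _ rfl
    exact hk G hG i

/-- Replacing `h` by `1_Q / μ(Q)^{1/2}` in a randomized sum increases it by at most a constant
factor: the averages of `|h|` over `Q` are comparable with `μ(Q)^{-1/2}`. -/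
theorem HaarSystem.signNorm_indicator_le {p B : ℝ} (hp : 1 ≤ p)
    (hB : HasUMDConstant.{u, v} E p B) (hμ : IsDoublingMeasure μ D) (hδ : 0 < δ) {n : ℕ}
    (hn : 30 / δ ≤ 2 ^ n) (hQ : Function.Injective Q) (hlev : Monotone fun i => (Q i).1)
    (θ : ∀ i, Fin (H.n (Q i))) (x : ι → E) :
    signNorm p μ (fun i => (𝒟.toSet (Q i)).indicator fun _ => (√(μ.real (𝒟.toSet (Q i))))⁻¹) x ≤
      NNReal.sqrt (D ^ n) * ((1 + ENNReal.ofReal B) *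
        signNorm p μ (fun i => H.h (Q i) (θ i)) x) := by
  have : SigmaFinite μ := hμ.sigmaFinite hδ 𝒟
  obtain ⟨k, hk⟩ := 𝒟.exists_range_cube_forall_subset_or_disjoint Q
  have hm : ∀ i, MeasurableSet (𝒟.toSet (Q i)) := fun i => 𝒟.measurableSet_toSet _
  let c : ι → ℝ := fun i => (∫ y, |H.h (Q i) (θ i) y| ∂μ) / μ.real (𝒟.toSet (Q i))
  have hstep : signNorm p μ (fun i => (𝒟.toSet (Q i)).indicator fun _ => c i) x ≤
      (1 + ENNReal.ofReal B) * signNorm p μ (fun i y => |H.h (Q i) (θ i) y|) x := by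
    refine signNorm_indicator_average_le hp hB hm
      (fun i => hμ.measure_toSet_lt_top hδ 𝒟 _)
      (fun i j hij => 𝒟.subset_or_disjoint (hlev hij.le)) (fun i => (H.measurable_h _ _).abs)
      (fun i y hy => by rw [H.apply_eq_zero _ _ hy, abs_zero])
      (fun i => ⟨_, fun y => by rw [abs_abs]; exact H.abs_h_le_const hμ hδ hn _ _ y⟩)
      (fun i j hij y hy z hz => ?_) (fun i => ?_) (𝒟.countable_range_cube k) ?_ ?_
      (𝒟.sUnion_range_cube k) hk x
    · rw [H.eq_on_cube (θ i) (hlev hij.le) (fun h => hij.ne' (hQ h)) hy hz]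
    · exact (div_mul_cancel₀ _
        (H.measureReal_toSet_pos _ (θ i) (hμ.measure_toSet_lt_top hδ 𝒟 _)).ne').symm
    · rintro _ ⟨α, rfl⟩
      exact 𝒟.measurableSet_cube k α
    · rintro _ ⟨α, rfl⟩
      exact hμ.measure_toSet_lt_top hδ 𝒟 ⟨k, α⟩
  refine (signNorm_le_mul hp μ (b := fun i => (𝒟.toSet (Q i)).indicator fun _ => c i)
    (fun i => measurable_const.indicator (hm i)) (fun i => measurable_const.indicator (hm i))
    (NNReal.sqrt (D ^ n)) (fun i y => ?_) x).trans ?_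
  · by_cases hy : y ∈ 𝒟.toSet (Q i)
    · rw [Set.indicator_of_mem hy, Set.indicator_of_mem hy, abs_of_nonneg (by positivity),
        Real.coe_sqrt]
      refine (H.inv_sqrt_le_average hμ hδ hn _ (θ i)).trans ?_
      gcongr
      exact le_abs_self _
    · simp [hy]
  · refine mul_le_mul_right (hstep.trans (mul_le_mul_right ?_ _)) _
    exact signNorm_mono hp μ (fun i => (H.measurable_h _ _).abs) (fun i => H.measurable_h _ _)
      (fun i y => by rw [abs_abs]) x

/-- The norm of `∑ i, h i x i` on the product of `X` with the sign vectors is comparable with that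
of `∑ i, ε i h i x i`. -/
theorem HaarSystem.eLpNorm_fst_le_and_ge {p β : ℝ} (hp : 0 < p)
    (hβ : HasUMDConstant.{u, v} E p β) (hμ : IsDoublingMeasure μ D) (hδ : 0 < δ)
    (hQ : Function.Injective Q) (hlev : Monotone fun i => (Q i).1)
    (θ : ∀ i, Fin (H.n (Q i))) (x : ι → E) :
    eLpNorm (fun s : X × (ι → Bool) => ∑ i, H.h (Q i) (θ i) s.1 • x i) (ENNReal.ofReal p)
        (μ.prod Measure.count) ≤
      ENNReal.ofReal β * signNorm p μ (fun i => H.h (Q i) (θ i)) x ∧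
    signNorm p μ (fun i => H.h (Q i) (θ i)) x ≤
      ENNReal.ofReal β * eLpNorm (fun s : X × (ι → Bool) => ∑ i, H.h (Q i) (θ i) s.1 • x i)
        (ENNReal.ofReal p) (μ.prod Measure.count) := by
  have : SigmaFinite μ := hμ.sigmaFinite hδ 𝒟
  have hhm : ∀ i, Measurable (H.h (Q i) (θ i)) := fun i => H.measurable_h _ _
  have hsm1 : StronglyMeasurable fun s : X × (ι → Bool) =>
      ∑ i, H.h (Q i) (θ i) s.1 • x i :=
    stronglyMeasurable_sum_smul (fun i => (hhm i).comp measurable_fst) x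
  have hsm2 : StronglyMeasurable fun s : X × (ι → Bool) =>
      ∑ i, (boolSign (s.2 i) * H.h (Q i) (θ i) s.1) • x i :=
    stronglyMeasurable_sum_smul (fun i =>
      (measurable_boolSign_eval i).mul ((hhm i).comp measurable_fst)) x
  have hle : ∀ ω : ι → Bool, eLpNorm (fun y => ∑ i, (boolSign (ω i) * H.h (Q i) (θ i) y) • x i)
      (ENNReal.ofReal p) μ ≤ ENNReal.ofReal β *
        eLpNorm (fun y => ∑ i, H.h (Q i) (θ i) y • x i) (ENNReal.ofReal p) μ := fun ω =>
    H.eLpNorm_sum_mul_le hβ hμ hδ hQ hlev θ x fun i => boolSign_eq (ω i)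
  have hge : ∀ ω : ι → Bool, eLpNorm (fun y => ∑ i, H.h (Q i) (θ i) y • x i)
      (ENNReal.ofReal p) μ ≤ ENNReal.ofReal β *
        eLpNorm (fun y => ∑ i, (boolSign (ω i) * H.h (Q i) (θ i) y) • x i)
          (ENNReal.ofReal p) μ := by
    intro ω
    -- signs square to one, so the inequality with `ε i x i` in place of `x i` is the reverse one
    have hsq : ∀ i t, boolSign (ω i) * t * boolSign (ω i) = t := fun i t => by
      rcases boolSign_eq (ω i) with h | h <;> simp [h]
    have h := H.eLpNorm_sum_mul_le hβ hμ hδ hQ hlev θ (fun i => boolSign (ω i) • x i)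
      (σ := fun i => boolSign (ω i)) fun i => boolSign_eq (ω i)
    simp only [smul_smul, hsq] at h
    simpa only [mul_comm (boolSign _)] using h
  exact ⟨eLpNorm_prod_count_le hp μ hsm1 hsm2 _ hge, eLpNorm_prod_count_le hp μ hsm2 hsm1 _ hle⟩

omit [CompleteSpace E] in
theorem HaarSystem.signNorm_le_indicator {p : ℝ} (hp : 1 ≤ p) (hμ : IsDoublingMeasure μ D)
    (hδ : 0 < δ) {n : ℕ} (hn : 30 / δ ≤ 2 ^ n) (θ : ∀ i, Fin (H.n (Q i))) (x : ι → E) :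
    signNorm p μ (fun i => H.h (Q i) (θ i)) x ≤ NNReal.sqrt (D ^ n) * signNorm p μ
      (fun i => (𝒟.toSet (Q i)).indicator fun _ => (√(μ.real (𝒟.toSet (Q i))))⁻¹) x := by
  have : SigmaFinite μ := hμ.sigmaFinite hδ 𝒟
  refine signNorm_le_mul hp μ (fun i => H.measurable_h _ _)
    (fun i => measurable_const.indicator (𝒟.measurableSet_toSet _)) _ (fun i y => ?_) x
  rw [Real.coe_sqrt]
  refine (H.abs_h_le hμ hδ hn _ (θ i) y).trans ?_
  gcongr
  exact le_abs_self _

/-- The two-sided estimate for cubes listed by nondecreasing level. -/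
theorem HaarSystem.eLpNorm_sum_le_and_ge {p β : ℝ} (hp : 1 ≤ p)
    (hβ : HasUMDConstant.{u, v} E p β) (hμ : IsDoublingMeasure μ D) (hδ : 0 < δ) {n : ℕ}
    (hn : 30 / δ ≤ 2 ^ n) (hQ : Function.Injective Q) (hlev : Monotone fun i => (Q i).1)
    (θ : ∀ i, Fin (H.n (Q i))) (x : ι → E) {Ω : Type w} [MeasurableSpace Ω] {P : Measure Ω}
    [IsProbabilityMeasure P] {ε : ι → Ω → ℝ} (hε : IsRandomSigns ε P) :
    eLpNorm (fun y => ∑ i, H.h (Q i) (θ i) y • x i) (ENNReal.ofReal p) μ ≤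
        (NNReal.sqrt (D ^ n) * (1 + β.toNNReal) ^ 2 : ℝ≥0) *
          randomizedNorm p P μ (fun η y => ∑ i, ε i η •
            (𝒟.toSet (Q i)).indicator (fun _ => (√(μ.real (𝒟.toSet (Q i))))⁻¹) y • x i) ∧
      randomizedNorm p P μ (fun η y => ∑ i, ε i η •
            (𝒟.toSet (Q i)).indicator (fun _ => (√(μ.real (𝒟.toSet (Q i))))⁻¹) y • x i) ≤
        (NNReal.sqrt (D ^ n) * (1 + β.toNNReal) ^ 2 : ℝ≥0) *
          eLpNorm (fun y => ∑ i, H.h (Q i) (θ i) y • x i) (ENNReal.ofReal p) μ := by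
  have : SigmaFinite μ := hμ.sigmaFinite hδ 𝒟
  have hp0 : 0 < p := by linarith
  have hhm : ∀ i, Measurable (H.h (Q i) (θ i)) := fun i => H.measurable_h _ _
  have hbm : ∀ i, Measurable ((𝒟.toSet (Q i)).indicator fun _ =>
      (√(μ.real (𝒟.toSet (Q i))))⁻¹) := fun i =>
    measurable_const.indicator (𝒟.measurableSet_toSet _)
  have hsm := stronglyMeasurable_sum_smul hhm x
  rw [hε.randomizedNorm_eq hp0 μ hbm, eLpNorm_eq_mul_prod_count (ι := ι) hp0 μ hsm]
  obtain ⟨h1, h2⟩ := H.eLpNorm_fst_le_and_ge hp0 hβ hμ hδ hQ hlev θ x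
  have h3 := H.signNorm_le_indicator hp hμ hδ hn θ x
  have h4 := H.signNorm_indicator_le hp hβ hμ hδ hn hQ hlev θ x
  have hof : ENNReal.ofReal β = β.toNNReal := rfl
  rw [hof] at h1 h2 h4
  generalize eLpNorm (fun s : X × (ι → Bool) => ∑ i, H.h (Q i) (θ i) s.1 • x i)
    (ENNReal.ofReal p) (μ.prod Measure.count) = N at *
  generalize signNorm p μ (fun i => (𝒟.toSet (Q i)).indicator fun _ =>
    (√(μ.real (𝒟.toSet (Q i))))⁻¹) x = a at *
  generalize signNorm p μ (fun i => H.h (Q i) (θ i)) x = h at *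
  rw [ENNReal.coe_mul, ENNReal.coe_pow, ENNReal.coe_add, ENNReal.coe_one]
  generalize (β.toNNReal : ℝ≥0∞) = B at *
  generalize (NNReal.sqrt (D ^ n) : ℝ≥0∞) = K at *
  have hB : B ≤ 1 + B := le_add_self
  have hC : B ≤ (1 + B) ^ 2 := hB.trans (le_self_pow₀ le_self_add two_ne_zero)
  rw [mul_left_comm, mul_left_comm (K * _)]
  refine ⟨mul_le_mul_right ?_ _, mul_le_mul_right ?_ _⟩
  · calc N ≤ B * (K * a) := h1.trans (by gcongr)
      _ ≤ (1 + B) ^ 2 * (K * a) := by gcongr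
      _ = _ := by ring
  · calc a ≤ K * ((1 + B) * (B * N)) := h4.trans (by gcongr)
      _ ≤ K * ((1 + B) * ((1 + B) * N)) := by gcongr
      _ = _ := by ring

end Haar

theorem mainTheorem4 (p : ℝ) (hp : 1 < p) (D : ℝ≥0) (δ : ℝ) (hδ0 : 0 < δ) (hδ1 : δ < 1) (β : ℝ) :
    ∃ C : ℝ≥0,
      ∀ (X : Type u) [MetricSpace X] [MeasurableSpace X] [BorelSpace X] (μ : Measure X),
        IsDoublingMeasure μ D →
      ∀ (E : Type v) [NormedAddCommGroup E] [NormedSpace ℝ E] [CompleteSpace E],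
        IsUMD.{u, v} E → HasUMDConstant.{u, v} E p β →
      ∀ (𝒟 : DyadicSystem X δ) (H : HaarSystem 𝒟 μ)
        (𝒬 : Finset 𝒟.Cube) (θ : ∀ Q : 𝒬, Fin (H.n Q)) (x : 𝒬 → E)
        (Ω : Type w) [MeasurableSpace Ω] (P : Measure Ω) [IsProbabilityMeasure P]
        (ε : 𝒬 → Ω → ℝ), IsRandomSigns ε P →
        eLpNorm (fun y => ∑ Q : 𝒬, H.h Q (θ Q) y • x Q) (ENNReal.ofReal p) μ ≤
            C * randomizedNorm p P μ (fun η y => ∑ Q : 𝒬, ε Q η •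
              (𝒟.toSet Q).indicator (fun _ => (√(μ.real (𝒟.toSet Q)))⁻¹) y • x Q) ∧
          randomizedNorm p P μ (fun η y => ∑ Q : 𝒬, ε Q η •
              (𝒟.toSet Q).indicator (fun _ => (√(μ.real (𝒟.toSet Q)))⁻¹) y • x Q) ≤
            C * eLpNorm (fun y => ∑ Q : 𝒬, H.h Q (θ Q) y • x Q) (ENNReal.ofReal p) μ := by
  -- `D ^ n` bounds the ratio between the measures of a cube and of its children
  obtain ⟨n, hn⟩ := pow_unbounded_of_one_lt (30 / δ) (one_lt_two : (1 : ℝ) < 2)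
  refine ⟨NNReal.sqrt (D ^ n) * (1 + β.toNNReal) ^ 2, ?_⟩
  intro X _ _ _ μ hμ E _ _ _ _ hβ 𝒟 H 𝒬 θ x Ω _ P _ ε hε
  -- order the cubes by their level, breaking ties by an arbitrary enumeration
  let r : 𝒬 → ℤ ×ₗ Fin (Fintype.card 𝒬) := fun Q => toLex (Q.1.1, Fintype.equivFin 𝒬 Q)
  have hr : Function.Injective r := fun Q R h =>
    (Fintype.equivFin 𝒬).injective (congrArg Prod.snd (toLex.injective h))
  let _ : LinearOrder 𝒬 := LinearOrder.lift' r hr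
  have hlev : Monotone fun Q : 𝒬 => (Q : 𝒟.Cube).1 := fun Q R h =>
    Prod.Lex.monotone_fst (r Q) (r R) h
  exact H.eLpNorm_sum_le_and_ge (Q := fun Q : 𝒬 => (Q : 𝒟.Cube)) hp.le hβ hμ hδ0 hn.le
    Subtype.val_injective hlev θ x hε
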